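/- Let $N\ge 1$, let $\Omega\subset\mathbb R^N$ be a bounded open set with $C^2$-boundary, and let $V\colon\mathbb R^N\to\mathbb R$ be a measurable function such that $0\le V\le 1$ a.e. in $\mathbb R^N$; $V=0$ a.e. in $\overline\Omega$; $\operatorname{ess\,inf}_{\overline{B_r(x_0)}}V>0$ for every closed ball $\overline{B_r(x_0)}\subset\mathbb R^N\setminus\overline\Omega$; and $\operatorname{ess\,lim}_{|x|\to\infty}V(x)=1$. All function spaces have real scalars, or all have complex scalars. For $\beta\ge 0$ put $V_\beta=1+\beta V$ and $$a_\beta(u,v)=\int_{\mathbb R^N}\nabla u\cdot\overline{\nabla v}\,dx+\int_{\mathbb R^N}V_\beta u\bar v\,dx,\qquad \|u\|_{1,\beta}=a_\beta(u,u)^{1/2},\qquad u,v\in H^1(\mathbb R^N).$$ Let $H^1_\Omega$ and $L^2_\Omega$ be the closed subspaces of $H^1(\mathbb R^N)$ and $L^2(\mathbb R^N)$ of functions vanishing a.e. outside $\Omega$. Let $A_\beta$ be the operator in $L^2(\mathbb R^N)$ associated with $a_\beta$: $u\in D(A_\beta)$ and $A_\beta u=w$ if and only if $u\in H^1(\mathbb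 R^N)$, $w\in L^2(\mathbb R^N)$ and $\langle w,v\rangle_{L^2}=a_\beta(u,v)$ for all $v\in H^1(\mathbb R^N)$ (so $A_\beta=-\Delta+V_\beta$). Let $A_\Omega$ be the operator in $L^2_\Omega$ associated in the same way with the $H^1$ scalar product on $H^1_\Omega$ (so $A_\Omega=-\Delta+I$ with Dirichlet condition on $\partial\Omega$). Let $X^1_\beta=H^1(\mathbb R^N)\times L^2(\mathbb R^N)$ with norm $\|(u,v)\|_{X^1_\beta}=(\|u\|_{1,\beta}^2+\|v\|_{L^2}^2)^{1/2}$, and $X^1_\Omega=H^1_\Omega\times L^2_\Omega\subset X^1_\beta$ with the norm $(\|u\|_{H^1}^2+\|v\|_{L^2}^2)^{1/2}$. For $\gamma\ge 0$ put $$B_\beta(u,v)=(v,-A_\beta u-\gamma v),\quad D(B_\beta)=D(A_\beta)\times H^1(\mathbb R^N),\qquad B_\Omega(u,v)=(v,-A_\Omega u-\gamma v),\quad D(B_\Omega)=D(A_\Omega)\times H^1_\Omega .$$ **Theorem.** Let $\delta\ge 0$ satisfy $2\delta\le\gamma$ and $\gamma\delta<1$, and let $\mu>-\delta$ be real. Let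 $(\beta_n)_{n\in\mathbb N}$ be a sequence of positive numbers with $\beta_n\to+\infty$. Then $\mu$ is in the resolvent set of $B_\Omega$ and of every $B_{\beta_n}$, and the following hold. 1. If $H\in X^1_\Omega$, $H_n\in X^1_{\beta_n}$ for every $n$, and $\|H_n-H\|_{X^1_{\beta_n}}\to 0$ as $n\to\infty$, then $$\|(B_{\beta_n}-\mu I)^{-1}H_n-(B_\Omega-\mu I)^{-1}H\|_{X^1_{\beta_n}}\to 0\quad\text{as } n\to\infty.$$ 2. For every compact set $\mathcal K\subset X^1_\Omega$, $$\sup_{W\in\mathcal K}\big\|\big((B_{\beta_n}-\mu I)^{-1}-(B_\Omega-\mu I)^{-1}\big)W\big\|_{X^1_{\beta_n}}\to 0\quad\text{as } n\to\infty .$$ -/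

import Mathlib

open MeasureTheory Filter Topology
open scoped ContDiff

namespace SteepWell

noncomputable section

/-! ## Function spaces on `ℝ^N`, with real or complex scalars -/

/-- Euclidean space `ℝ^N`. -/
abbrev E (N : ℕ) := EuclideanSpace ℝ (Fin N)

/-- `L²(ℝ^N)` with values in `𝕜` (`ℝ` or `ℂ`). -/
abbrev L2 (𝕜 : Type*) [RCLike 𝕜] (N : ℕ) := Lp 𝕜 2 (volume : Measure (E N))

variable {𝕜 : Type*} [RCLike 𝕜] {N : ℕ}

/-- `g ∈ L²` is the weak partial derivative `∂ᵢ u` of `u ∈ L²`. -/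
def IsWeakPartial (i : Fin N) (u g : L2 𝕜 N) : Prop :=
  ∀ φ : E N → ℝ, ContDiff ℝ ∞ φ → HasCompactSupport φ →
    ∫ x, fderiv ℝ φ x (EuclideanSpace.single i 1) • u x = - ∫ x, φ x • g x

/-- A smooth compactly supported function times an `L²` function is integrable. -/
lemma integrable_test_smul {φ : E N → ℝ} (hc : Continuous φ) (hs : HasCompactSupport φ)
    (u : L2 𝕜 N) : Integrable (fun x => φ x • u x) :=
  ((Lp.memLp u).locallyIntegrable one_le_two).integrable_smul_left_of_hasCompactSupport hc hs

lemma continuous_partial {φ : E N → ℝ} (h : ContDiff ℝ ∞ φ) (y : E N) :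
    Continuous (fun x => fderiv ℝ φ x y) :=
  (h.continuous_fderiv (by simp)).clm_apply continuous_const

/-- Weak partial derivatives are unique. -/
lemma IsWeakPartial.unique {i : Fin N} {u g g' : L2 𝕜 N}
    (h : IsWeakPartial i u g) (h' : IsWeakPartial i u g') : g = g' := by
  apply Lp.ext
  refine ae_eq_of_integral_contDiff_smul_eq ((Lp.memLp g).locallyIntegrable one_le_two)
    ((Lp.memLp g').locallyIntegrable one_le_two) (fun φ hφ hs => ?_)
  exact neg_injective ((h φ hφ hs).symm.trans (h' φ hφ hs))

/-- The Sobolev space `H¹(ℝ^N)`, as a space of pairs: an element is an `L²` function `u` together with its weak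
gradient `(∂₁u, …, ∂_N u)`, all of whose components are in `L²`. The norm inherited from the
`ℓ²`-product is the standard one, `‖u‖² = ‖u‖²_{L²} + ∑ᵢ ‖∂ᵢu‖²_{L²}`. The gradient is determined
by `u`, see `toL2_injective`. -/
def H1Submodule (𝕜 : Type*) [RCLike 𝕜] (N : ℕ) :
    Submodule 𝕜 (WithLp 2 (L2 𝕜 N × PiLp 2 (fun _ : Fin N => L2 𝕜 N))) where
  carrier := {p | ∀ i, IsWeakPartial i p.fst (p.snd i)}
  zero_mem' := by
    intro i φ hφ hs
    have e : ∀ (ψ : E N → ℝ), ∫ x, ψ x • (0 : L2 𝕜 N) x = 0 := fun ψ => by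
      rw [← integral_zero (E N) 𝕜]
      refine integral_congr_ae ?_
      filter_upwards [Lp.coeFn_zero 𝕜 2 (volume : Measure (E N))] with x hx
      rw [hx, Pi.zero_apply, smul_zero]
    exact (e _).trans (by rw [← neg_zero]; exact congrArg Neg.neg (e φ).symm)
  add_mem' := by
    intro p q hp hq i φ hφ hs
    have e : ∀ (ψ : E N → ℝ) (u v : L2 𝕜 N), Continuous ψ → HasCompactSupport ψ →
        ∫ x, ψ x • (u + v) x = (∫ x, ψ x • u x) + ∫ x, ψ x • v x := fun ψ u v hc hs => by
      rw [← integral_add (integrable_test_smul hc hs u) (integrable_test_smul hc hs v)]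
      refine integral_congr_ae ?_
      filter_upwards [Lp.coeFn_add u v] with x hx
      rw [hx, Pi.add_apply, smul_add]
    have h1 := e _ p.fst q.fst (continuous_partial hφ (EuclideanSpace.single i 1))
      (hs.fderiv_apply ℝ (EuclideanSpace.single i 1))
    have h2 := e φ (p.snd i) (q.snd i) hφ.continuous hs
    change ∫ x, fderiv ℝ φ x (EuclideanSpace.single i 1) • (p.fst + q.fst) x
      = - ∫ x, φ x • (p.snd i + q.snd i) x
    rw [h1, h2, hp i φ hφ hs, hq i φ hφ hs, neg_add]
  smul_mem' := by
    intro c p hp i φ hφ hs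
    have e : ∀ (ψ : E N → ℝ) (u : L2 𝕜 N),
        ∫ x, ψ x • (c • u) x = c * ∫ x, ψ x • u x := fun ψ u => by
      rw [← integral_const_mul]
      refine integral_congr_ae ?_
      filter_upwards [Lp.coeFn_smul c u] with x hx
      simp [hx]
    change ∫ x, fderiv ℝ φ x (EuclideanSpace.single i 1) • (c • p.fst) x
      = - ∫ x, φ x • (c • p.snd i) x
    rw [e, e, hp i φ hφ hs, mul_neg]

/-- The Hilbert space `H¹(ℝ^N)`. -/
def H1 (𝕜 : Type*) [RCLike 𝕜] (N : ℕ) : Type _ := H1Submodule 𝕜 N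

instance : NormedAddCommGroup (H1 𝕜 N) :=
  inferInstanceAs (NormedAddCommGroup (H1Submodule 𝕜 N))

instance : InnerProductSpace 𝕜 (H1 𝕜 N) :=
  inferInstanceAs (InnerProductSpace 𝕜 (H1Submodule 𝕜 N))

/-- The embedding `H¹(ℝ^N) → L²(ℝ^N)`. -/
def toL2 (𝕜 : Type*) [RCLike 𝕜] (N : ℕ) : H1 𝕜 N →L[𝕜] L2 𝕜 N :=
  (WithLp.fstL 2 𝕜 (L2 𝕜 N) (PiLp 2 (fun _ : Fin N => L2 𝕜 N))) ∘L (H1Submodule 𝕜 N).subtypeL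

/-- The weak partial derivative `∂ᵢ u` of `u ∈ H¹(ℝ^N)`. -/
def partialDeriv (i : Fin N) (u : H1 𝕜 N) : L2 𝕜 N := u.1.snd i

lemma toL2_injective : Function.Injective (toL2 𝕜 N) := by
  intro u v h
  have h' : u.1.fst = v.1.fst := h
  have h2 : u.1.snd = v.1.snd := by
    ext1 i
    have hu := u.2 i
    rw [h'] at hu
    exact hu.unique (v.2 i)
  apply Subtype.ext
  apply WithLp.ofLp_injective
  exact Prod.ext h' h2

/-- `L²_Ω(ℝ^N)`: the functions in `L²(ℝ^N)` that vanish almost everywhere outside `Ω`. -/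
def L2Ω (𝕜 : Type*) [RCLike 𝕜] {N : ℕ} (Ω : Set (E N)) : Submodule 𝕜 (L2 𝕜 N) where
  carrier := {f | ∀ᵐ x : E N, x ∉ Ω → f x = 0}
  zero_mem' := by
    filter_upwards [Lp.coeFn_zero 𝕜 2 (volume : Measure (E N))] with x hx _
    rw [hx, Pi.zero_apply]
  add_mem' := by
    intro f g hf hg
    filter_upwards [hf, hg, Lp.coeFn_add f g] with x h1 h2 h3 hx
    rw [h3, Pi.add_apply, h1 hx, h2 hx, add_zero]
  smul_mem' := by
    intro c f hf
    filter_upwards [hf, Lp.coeFn_smul c f] with x h1 h2 hx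
    rw [h2, Pi.smul_apply, h1 hx, smul_zero]

/-- `H¹_Ω(ℝ^N)`: the functions in `H¹(ℝ^N)` that vanish almost everywhere outside `Ω`. -/
def H1Ω (𝕜 : Type*) [RCLike 𝕜] {N : ℕ} (Ω : Set (E N)) : Submodule 𝕜 (H1 𝕜 N) :=
  (L2Ω 𝕜 Ω).comap (toL2 𝕜 N : H1 𝕜 N →ₗ[𝕜] L2 𝕜 N)

/-- The embedding `H¹_Ω(ℝ^N) → L²_Ω(ℝ^N)`. -/
def toL2Ω (𝕜 : Type*) [RCLike 𝕜] {N : ℕ} (Ω : Set (E N)) : H1Ω 𝕜 Ω →L[𝕜] L2Ω 𝕜 Ω :=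
  ((toL2 𝕜 N) ∘L (H1Ω 𝕜 Ω).subtypeL).codRestrict (L2Ω 𝕜 Ω) (fun u => u.2)

lemma toL2Ω_injective (Ω : Set (E N)) : Function.Injective (toL2Ω 𝕜 Ω) := by
  intro u v h
  exact Subtype.ext (toL2_injective (congrArg Subtype.val h))

/-! ## The domain and the potential -/

/-- `Ω` has boundary of class `C²`: near each boundary point, `Ω` is the sublevel set `{ρ < 0}`
of a `C²` function `ρ` whose differential does not vanish at that point. -/
def HasC2Boundary (Ω : Set (E N)) : Prop :=
  ∀ x₀ ∈ frontier Ω, ∃ (U : Set (E N)) (ρ : E N → ℝ), IsOpen U ∧ x₀ ∈ U ∧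
    ContDiffOn ℝ 2 ρ U ∧ fderiv ℝ ρ x₀ ≠ 0 ∧ ∀ x ∈ U, (x ∈ Ω ↔ ρ x < 0)

/-- A (Lebesgue measurable) well potential with bottom `Ω`. -/
structure IsWellPotential (Ω : Set (E N)) (V : E N → ℝ) : Prop where
  aemeasurable : AEMeasurable V
  mem_Icc : ∀ᵐ x : E N, 0 ≤ V x ∧ V x ≤ 1
  eq_zero : ∀ᵐ x : E N, x ∈ closure Ω → V x = 0
  /-- `ess inf V > 0` on every closed ball contained in the complement of `closure Ω` -/
  essInf_pos : ∀ (x₀ : E N) (r : ℝ), 0 < r → Metric.closedBall x₀ r ⊆ (closure Ω)ᶜ →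
    ∃ c : ℝ, 0 < c ∧ ∀ᵐ x : E N, x ∈ Metric.closedBall x₀ r → c ≤ V x
  /-- `ess lim V(x) = 1` as `|x| → ∞` -/
  essLim : ∀ ε : ℝ, 0 < ε → ∃ R : ℝ, ∀ᵐ x : E N, R ≤ ‖x‖ → |V x - 1| < ε

/-! ## The form `a_β`, and the operator associated with a form -/

/-- `a_β(u, v) = ∫ ∇u · ∇v̄ + ∫ V_β u v̄`, where `V_β = 1 + β V`.
(Mathlib's `inner 𝕜 f g` is linear in `g` and conjugate-linear in `f`.) -/
def energy (V : E N → ℝ) (β : ℝ) (u v : H1 𝕜 N) : 𝕜 :=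
  ∑ i : Fin N, inner 𝕜 (partialDeriv i v) (partialDeriv i u)
    + ∫ x : E N, (1 + β * V x) • inner 𝕜 (toL2 𝕜 N v x) (toL2 𝕜 N u x)

/-- `‖u‖_{1,β} = a_β(u, u)^{1/2}`. -/
def norm1 (V : E N → ℝ) (β : ℝ) (u : H1 𝕜 N) : ℝ := √(RCLike.re (energy V β u u))

lemma integrable_energy {Ω : Set (E N)} {V : E N → ℝ} (hV : IsWellPotential Ω V) (β : ℝ)
    (f g : L2 𝕜 N) : Integrable (fun x : E N => (1 + β * V x) • inner 𝕜 (f x) (g x)) := by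
  have hfg : Integrable (fun x : E N => (inner 𝕜 (f x) (g x) : 𝕜)) := L2.integrable_inner f g
  refine hfg.bdd_smul (φ := fun x => 1 + β * V x) (C := 1 + |β|) ?_ ?_
  · exact ((hV.aemeasurable.const_mul β).const_add 1).aestronglyMeasurable
  · filter_upwards [hV.mem_Icc] with x hx
    calc ‖1 + β * V x‖ ≤ ‖(1 : ℝ)‖ + ‖β * V x‖ := norm_add_le _ _
      _ = 1 + |β| * V x := by rw [norm_mul, norm_one, Real.norm_eq_abs, Real.norm_eq_abs,
          abs_of_nonneg hx.1]
      _ ≤ 1 + |β| := by nlinarith [abs_nonneg β]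

/-- `a_β` as a sesquilinear form on `H¹(ℝ^N)`. -/
def energyForm {Ω : Set (E N)} {V : E N → ℝ} (hV : IsWellPotential Ω V) (β : ℝ) :
    H1 𝕜 N →ₗ[𝕜] H1 𝕜 N →ₗ⋆[𝕜] 𝕜 :=
  LinearMap.mk₂'ₛₗ (RingHom.id 𝕜) (starRingEnd 𝕜) (energy V β)
    (by
      intro u u' v
      have h : ∫ x : E N, (1 + β * V x) • inner 𝕜 (toL2 𝕜 N v x) (toL2 𝕜 N (u + u') x)
          = (∫ x : E N, (1 + β * V x) • inner 𝕜 (toL2 𝕜 N v x) (toL2 𝕜 N u x))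
            + ∫ x : E N, (1 + β * V x) • inner 𝕜 (toL2 𝕜 N v x) (toL2 𝕜 N u' x) := by
        rw [← integral_add (integrable_energy hV β _ _) (integrable_energy hV β _ _)]
        refine integral_congr_ae ?_
        rw [map_add]
        filter_upwards [Lp.coeFn_add (toL2 𝕜 N u) (toL2 𝕜 N u')] with x hx
        simp only [hx, Pi.add_apply, inner_add_right, smul_add]
      have h' : ∀ i, partialDeriv i (u + u') = partialDeriv i u + partialDeriv i u' :=
        fun i => rfl
      simp only [energy, h, h', inner_add_right, Finset.sum_add_distrib]
      ring)
    (by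
      intro c u v
      have h : ∫ x : E N, (1 + β * V x) • inner 𝕜 (toL2 𝕜 N v x) (toL2 𝕜 N (c • u) x)
          = c * ∫ x : E N, (1 + β * V x) • inner 𝕜 (toL2 𝕜 N v x) (toL2 𝕜 N u x) := by
        rw [← integral_const_mul]
        refine integral_congr_ae ?_
        rw [map_smul]
        filter_upwards [Lp.coeFn_smul c (toL2 𝕜 N u)] with x hx
        simp only [hx, Pi.smul_apply, inner_smul_right, mul_smul_comm]
      have h' : ∀ i, partialDeriv i (c • u) = c • partialDeriv i u := fun i => rfl
      simp only [energy, h, h', inner_smul_right, ← Finset.mul_sum, RingHom.id_apply, smul_eq_mul]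
      ring)
    (by
      intro u v v'
      have h : ∫ x : E N, (1 + β * V x) • inner 𝕜 (toL2 𝕜 N (v + v') x) (toL2 𝕜 N u x)
          = (∫ x : E N, (1 + β * V x) • inner 𝕜 (toL2 𝕜 N v x) (toL2 𝕜 N u x))
            + ∫ x : E N, (1 + β * V x) • inner 𝕜 (toL2 𝕜 N v' x) (toL2 𝕜 N u x) := by
        rw [← integral_add (integrable_energy hV β _ _) (integrable_energy hV β _ _)]
        refine integral_congr_ae ?_
        rw [map_add]
        filter_upwards [Lp.coeFn_add (toL2 𝕜 N v) (toL2 𝕜 N v')] with x hx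
        simp only [hx, Pi.add_apply, inner_add_left, smul_add]
      have h' : ∀ i, partialDeriv i (v + v') = partialDeriv i v + partialDeriv i v' :=
        fun i => rfl
      simp only [energy, h, h', inner_add_left, Finset.sum_add_distrib]
      ring)
    (by
      intro c u v
      have h : ∫ x : E N, (1 + β * V x) • inner 𝕜 (toL2 𝕜 N (c • v) x) (toL2 𝕜 N u x)
          = starRingEnd 𝕜 c *
            ∫ x : E N, (1 + β * V x) • inner 𝕜 (toL2 𝕜 N v x) (toL2 𝕜 N u x) := by
        rw [← integral_const_mul]
        refine integral_congr_ae ?_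
        rw [map_smul]
        filter_upwards [Lp.coeFn_smul c (toL2 𝕜 N v)] with x hx
        simp only [hx, Pi.smul_apply, inner_smul_left, mul_smul_comm]
      have h' : ∀ i, partialDeriv i (c • v) = c • partialDeriv i v := fun i => rfl
      simp only [energy, h, h', inner_smul_left, ← Finset.mul_sum, smul_eq_mul]
      ring)

section FormOperator

variable {G L : Type*} [NormedAddCommGroup G] [InnerProductSpace 𝕜 G]
  [NormedAddCommGroup L] [InnerProductSpace 𝕜 L]

/-- The graph of the operator associated with a form `a` on `G`, where `j : G → L` is an embedding:
the pairs `(j u, w)` such that `⟨w, j v⟩ = a(u, v)` for all `v ∈ G`. -/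
def formGraph (j : G →L[𝕜] L) (a : G →ₗ[𝕜] G →ₗ⋆[𝕜] 𝕜) : Submodule 𝕜 (L × L) where
  carrier := {p | ∃ u : G, j u = p.1 ∧ ∀ v : G, inner 𝕜 (j v) p.2 = a u v}
  zero_mem' := ⟨0, by simp, by simp⟩
  add_mem' := by
    rintro p q ⟨u, hu, hu'⟩ ⟨w, hw, hw'⟩
    exact ⟨u + w, by simp [hu, hw], fun v => by simp [inner_add_right, hu' v, hw' v]⟩
  smul_mem' := by
    rintro c p ⟨u, hu, hu'⟩
    exact ⟨c • u, by simp [hu], fun v => by simp [inner_smul_right, hu' v]⟩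

/-- The operator in `L` associated with the form `a` on `G`, that is, the part in `L` of the map
`G → G*`, `u ↦ a(u, ·)`. -/
def formOp (j : G →L[𝕜] L) (a : G →ₗ[𝕜] G →ₗ⋆[𝕜] 𝕜) : L →ₗ.[𝕜] L :=
  (formGraph j a).toLinearPMap

/-- If `j` is injective with dense range, the graph of `formOp j a` is `formGraph j a`. -/
lemma formOp_graph {j : G →L[𝕜] L} (hj : Function.Injective j)
    (hd : ∀ w : L, (∀ v, inner 𝕜 (j v) w = 0) → w = 0) (a : G →ₗ[𝕜] G →ₗ⋆[𝕜] 𝕜) :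
    (formOp j a).graph = formGraph j a := by
  apply Submodule.toLinearPMap_graph_eq
  rintro x ⟨u, hu, hu'⟩ hx
  have : u = 0 := hj (by rw [hu, hx, map_zero])
  subst this
  exact hd _ (fun v => by rw [hu' v]; simp)

/-- The first-order system `(u, v) ↦ (v, -A u - γ v)` in `G × L`, with domain `D(A) × G`. -/
def waveOp (j : G →L[𝕜] L) (hj : Function.Injective j) (A : L →ₗ.[𝕜] L) (γ : ℝ) :
    WithLp 2 (G × L) →ₗ.[𝕜] WithLp 2 (G × L) where
  domain :=
    { carrier := {U | j U.fst ∈ A.domain ∧ U.snd ∈ (j : G →ₗ[𝕜] L).range}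
      zero_mem' := ⟨by simp, by simp⟩
      add_mem' := by
        rintro U W ⟨h1, h2⟩ ⟨h3, h4⟩
        exact ⟨by simpa using A.domain.add_mem h1 h3, by simpa using add_mem h2 h4⟩
      smul_mem' := by
        rintro c U ⟨h1, h2⟩
        exact ⟨by simpa using A.domain.smul_mem c h1, by
          simpa using Submodule.smul_mem _ c h2⟩ }
  toFun :=
    { toFun := fun U => WithLp.toLp 2
        ((LinearEquiv.ofInjective (j : G →ₗ[𝕜] L) hj).symm ⟨U.1.snd, U.2.2⟩,
          -A ⟨j U.1.fst, U.2.1⟩ - (γ : 𝕜) • U.1.snd)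
      map_add' := by
        intro U W
        have h1 : (⟨(U + W).1.snd, (U + W).2.2⟩ : (j : G →ₗ[𝕜] L).range)
            = ⟨U.1.snd, U.2.2⟩ + ⟨W.1.snd, W.2.2⟩ := rfl
        have h2 : (⟨j (U + W).1.fst, (U + W).2.1⟩ : A.domain)
            = ⟨j U.1.fst, U.2.1⟩ + ⟨j W.1.fst, W.2.1⟩ := Subtype.ext (by simp)
        have h3 : (U + W).1.snd = U.1.snd + W.1.snd := rfl
        rw [h1, h2, h3, map_add, A.map_add, ← WithLp.toLp_add, Prod.mk_add_mk]
        congr 2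
        rw [smul_add]
        abel
      map_smul' := by
        intro c U
        have h1 : (⟨(c • U).1.snd, (c • U).2.2⟩ : (j : G →ₗ[𝕜] L).range)
            = c • ⟨U.1.snd, U.2.2⟩ := rfl
        have h2 : (⟨j (c • U).1.fst, (c • U).2.1⟩ : A.domain)
            = c • ⟨j U.1.fst, U.2.1⟩ := Subtype.ext (by simp)
        have h3 : (c • U).1.snd = c • U.1.snd := rfl
        rw [h1, h2, h3, map_smul, A.map_smul, RingHom.id_apply, ← WithLp.toLp_smul, Prod.smul_mk]
        congr 2
        rw [smul_sub, smul_neg, smul_comm] }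

/-- `R` is a bounded inverse `(T - μ I)⁻¹` of `T - μ I : D(T) → X`. -/
def IsInverseShift {X : Type*} [NormedAddCommGroup X] [NormedSpace 𝕜 X]
    (T : X →ₗ.[𝕜] X) (μ : 𝕜) (R : X →L[𝕜] X) : Prop :=
  (∀ h : X, ∃ u : T.domain, (u : X) = R h ∧ T u - μ • (u : X) = h) ∧
    ∀ u : T.domain, R (T u - μ • (u : X)) = u

/-- The resolvent set of `T`. -/
def resolventSetOf {X : Type*} [NormedAddCommGroup X] [NormedSpace 𝕜 X]
    (T : X →ₗ.[𝕜] X) : Set 𝕜 :=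
  {μ | ∃ R : X →L[𝕜] X, IsInverseShift T μ R}

open Classical in
/-- `(T - μ I)⁻¹` for `μ` in the resolvent set of `T` (and `0` otherwise). -/
def resolventInv {X : Type*} [NormedAddCommGroup X] [NormedSpace 𝕜 X]
    (T : X →ₗ.[𝕜] X) (μ : 𝕜) : X →L[𝕜] X :=
  if h : μ ∈ resolventSetOf T then Classical.choose h else 0

lemma resolventInv_eq {X : Type*} [NormedAddCommGroup X] [NormedSpace 𝕜 X]
    {T : X →ₗ.[𝕜] X} {μ : 𝕜} {R : X →L[𝕜] X} (hR : IsInverseShift T μ R) :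
    resolventInv T μ = R := by
  have h : μ ∈ resolventSetOf T := ⟨R, hR⟩
  rw [resolventInv, dif_pos h]
  ext x
  obtain ⟨u, hu, hx⟩ := hR.1 x
  rw [← hu, ← hx]
  exact (Classical.choose_spec h).2 u

end FormOperator

/-- `H¹(ℝ^N)` is dense in `L²(ℝ^N)`, and `H¹_Ω(ℝ^N)` is dense in `L²_Ω(ℝ^N)` for open `Ω`. -/
lemma eq_zero_of_orthogonal {Ω : Set (E N)} (hΩ : IsOpen Ω) (w : L2 𝕜 N) (hw : w ∈ L2Ω 𝕜 Ω)
    (h : ∀ v ∈ H1Ω 𝕜 Ω, inner 𝕜 (toL2 𝕜 N v) w = 0) : w = 0 := by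
  have hcl : ∀ φ : E N → ℝ, ContDiff ℝ ∞ φ → HasCompactSupport φ → tsupport φ ⊆ Ω →
      ∫ x, φ x • w x = 0 := by
    intro φ hφ hs hsub
    have hmem : ∀ ψ : E N → ℝ, Continuous ψ → HasCompactSupport ψ →
        MemLp (fun x => (ψ x : 𝕜)) 2 (volume : Measure (E N)) := fun ψ hc hs' =>
      (RCLike.continuous_ofReal.comp hc).memLp_of_hasCompactSupport
        (hs'.comp_left (g := ((↑) : ℝ → 𝕜)) (by simp))
    have hcp := fun i : Fin N => continuous_partial hφ (EuclideanSpace.single i 1)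
    have hsp := fun i : Fin N => hs.fderiv_apply ℝ (EuclideanSpace.single i (1 : ℝ))
    let f : L2 𝕜 N := (hmem φ hφ.continuous hs).toLp _
    let g : Fin N → L2 𝕜 N := fun i => (hmem _ (hcp i) (hsp i)).toLp _
    have hf : ∀ᵐ x : E N, f x = (φ x : 𝕜) := MemLp.coeFn_toLp _
    have hg : ∀ i, ∀ᵐ x : E N, g i x = (fderiv ℝ φ x (EuclideanSpace.single i 1) : 𝕜) :=
      fun i => MemLp.coeFn_toLp _
    have hweak : ∀ i, IsWeakPartial i f (g i) := by
      intro i ψ hψ hψs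
      have e1 : ∫ x, fderiv ℝ ψ x (EuclideanSpace.single i 1) • f x
          = ((∫ x, φ x * fderiv ℝ ψ x (EuclideanSpace.single i 1) : ℝ) : 𝕜) := by
        rw [← integral_ofReal]
        refine integral_congr_ae ?_
        filter_upwards [hf] with x hx
        rw [hx, RCLike.real_smul_eq_coe_mul]
        push_cast
        ring
      have e2 : ∫ x, ψ x • g i x
          = ((∫ x, fderiv ℝ φ x (EuclideanSpace.single i 1) * ψ x : ℝ) : 𝕜) := by
        rw [← integral_ofReal]
        refine integral_congr_ae ?_
        filter_upwards [hg i] with x hx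
        rw [hx, RCLike.real_smul_eq_coe_mul]
        push_cast
        ring
      rw [e1, e2, ← RCLike.ofReal_neg]
      congr 1
      have hψc := continuous_partial hψ (EuclideanSpace.single i 1)
      refine integral_mul_fderiv_eq_neg_fderiv_mul_of_integrable ?_ ?_ ?_
        (fun x _ => hφ.differentiable (by simp) x) (fun x _ => hψ.differentiable (by simp) x)
      · exact ((hcp i).mul hψ.continuous).integrable_of_hasCompactSupport hψs.mul_left
      · exact (hφ.continuous.mul hψc).integrable_of_hasCompactSupport hs.mul_right
      · exact (hφ.continuous.mul hψ.continuous).integrable_of_hasCompactSupport hs.mul_right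
    let v : H1 𝕜 N := ⟨WithLp.toLp 2 (f, WithLp.toLp 2 g), hweak⟩
    have hvf : toL2 𝕜 N v = f := rfl
    have hv : v ∈ H1Ω 𝕜 Ω := by
      change ∀ᵐ x : E N, x ∉ Ω → f x = 0
      filter_upwards [hf] with x hx hxΩ
      rw [hx, image_eq_zero_of_notMem_tsupport (fun hx' => hxΩ (hsub hx')), RCLike.ofReal_zero]
    have h0 := h v hv
    rw [hvf, L2.inner_def] at h0
    rw [← h0]
    refine integral_congr_ae ?_
    filter_upwards [hf] with x hx
    rw [hx, RCLike.inner_apply, RCLike.conj_ofReal, RCLike.real_smul_eq_coe_mul, mul_comm]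
  have hz := hΩ.ae_eq_zero_of_integral_contDiff_smul_eq_zero
    (((Lp.memLp w).locallyIntegrable one_le_two).locallyIntegrableOn Ω) hcl
  apply Lp.ext
  filter_upwards [hz, hw, Lp.coeFn_zero 𝕜 2 (volume : Measure (E N))] with x h1 h2 h3
  rw [h3]
  by_cases hx : x ∈ Ω
  · exact h1 hx
  · exact h2 hx

/-! ## The operators of the problem -/

/-- The selfadjoint operator `A_β = -Δ + V_β` in `L²(ℝ^N)`, associated with the form `a_β`. -/
def Aβ (𝕜 : Type*) [RCLike 𝕜] {N : ℕ} {Ω : Set (E N)} {V : E N → ℝ}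
    (hV : IsWellPotential Ω V) (β : ℝ) : L2 𝕜 N →ₗ.[𝕜] L2 𝕜 N :=
  formOp (toL2 𝕜 N) (energyForm hV β)

/-- The selfadjoint operator `A_Ω = -Δ + I` in `L²_Ω(ℝ^N)` (Dirichlet condition on `∂Ω`),
associated with the scalar product of `H¹_Ω(ℝ^N)`. -/
def AΩ (𝕜 : Type*) [RCLike 𝕜] {N : ℕ} (Ω : Set (E N)) : L2Ω 𝕜 Ω →ₗ.[𝕜] L2Ω 𝕜 Ω :=
  formOp (toL2Ω 𝕜 Ω) (innerₛₗ 𝕜 (E := H1Ω 𝕜 Ω)).flip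

lemma Aβ_graph {Ω : Set (E N)} {V : E N → ℝ} (hV : IsWellPotential Ω V) (β : ℝ) :
    (Aβ 𝕜 hV β).graph = formGraph (toL2 𝕜 N) (energyForm hV β) := by
  refine formOp_graph toL2_injective (fun w hw => ?_) _
  have hw' : w ∈ L2Ω 𝕜 (Set.univ : Set (E N)) := by
    change ∀ᵐ x : E N, x ∉ Set.univ → w x = 0
    exact Eventually.of_forall fun x hx => absurd (Set.mem_univ x) hx
  exact eq_zero_of_orthogonal isOpen_univ w hw' (fun v _ => hw v)

lemma AΩ_graph {Ω : Set (E N)} (hΩ : IsOpen Ω) :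
    (AΩ 𝕜 Ω).graph = formGraph (toL2Ω 𝕜 Ω) (innerₛₗ 𝕜 (E := H1Ω 𝕜 Ω)).flip := by
  rw [AΩ]
  apply formOp_graph (j := toL2Ω 𝕜 Ω)
  · exact toL2Ω_injective Ω
  intro w hw
  have hw0 : (w : L2 𝕜 N) = 0 := by
    refine eq_zero_of_orthogonal hΩ _ w.2 (fun v hv => ?_)
    have := hw ⟨v, hv⟩
    rwa [Submodule.coe_inner] at this
  exact Subtype.ext hw0

/-- The vector space `H¹(ℝ^N) × L²(ℝ^N)` underlying all the spaces `X¹_β`, with the norm of `X¹_0`;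
the (equivalent) norm of `X¹_β` is `normX V β`. -/
abbrev X (𝕜 : Type*) [RCLike 𝕜] (N : ℕ) := WithLp 2 (H1 𝕜 N × L2 𝕜 N)

/-- The norm of `X¹_β`: `‖(u, v)‖ = (‖u‖²_{1,β} + ‖v‖²_{L²})^{1/2}`. -/
def normX (V : E N → ℝ) (β : ℝ) (U : X 𝕜 N) : ℝ := √(norm1 V β U.fst ^ 2 + ‖U.snd‖ ^ 2)

/-- The Hilbert space `X¹_Ω = H¹_Ω(ℝ^N) × L²_Ω(ℝ^N)`. -/
abbrev XΩ (𝕜 : Type*) [RCLike 𝕜] {N : ℕ} (Ω : Set (E N)) := WithLp 2 (H1Ω 𝕜 Ω × L2Ω 𝕜 Ω)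

/-- The inclusion of `X¹_Ω` in `H¹(ℝ^N) × L²(ℝ^N)`. -/
def incl {Ω : Set (E N)} (U : XΩ 𝕜 Ω) : X 𝕜 N :=
  WithLp.toLp 2 ((U.fst : H1 𝕜 N), (U.snd : L2 𝕜 N))

/-- `B_β (u, v) = (v, -A_β u - γ v)`, with domain `D(A_β) × H¹(ℝ^N)`. -/
def Bβ (𝕜 : Type*) [RCLike 𝕜] {N : ℕ} {Ω : Set (E N)} {V : E N → ℝ}
    (hV : IsWellPotential Ω V) (γ β : ℝ) : X 𝕜 N →ₗ.[𝕜] X 𝕜 N :=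
  waveOp (toL2 𝕜 N) toL2_injective (Aβ 𝕜 hV β) γ

/-- `B_Ω (u, v) = (v, -A_Ω u - γ v)`, with domain `D(A_Ω) × H¹_Ω(ℝ^N)`. -/
def BΩ (𝕜 : Type*) [RCLike 𝕜] {N : ℕ} (Ω : Set (E N)) (γ : ℝ) : XΩ 𝕜 Ω →ₗ.[𝕜] XΩ 𝕜 Ω :=
  waveOp (toL2Ω 𝕜 Ω) (toL2Ω_injective Ω) (AΩ 𝕜 Ω) γ

end

end SteepWell

open SteepWell

open SteepWell

/-! Eliminating `v = f + μ u` from `(B - μ)(u, v) = (f, g)` leaves one elliptic equation, `A u + κ u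
= -g - (γ + μ) f` with `κ = μ (γ + μ)`. The conditions on `δ` and `μ` give `κ > -1`, so this
equation is coercive with a constant independent of `β`, and Lax–Milgram yields the resolvents
(`exists_isInverseShift_waveOp`).

With `m u = √V u` the form is `a_β(u, v) = ⟨u, v⟩_{H¹} + β ⟨m u, m v⟩`, and `ker m = H¹_Ω`, because
`V` vanishes exactly on `Ω` up to a null set. The limit `β → ∞` is therefore a penalization problem
in Hilbert space. The limit solution satisfies its equation only against `ker m`, so its residual
lies in `(ker m)ᗮ`, the closure of the range of `m†`. Approximate the residual by `m† z`. Pairing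
`m† z` with the error `e` gives `⟨m e, z⟩`, which is at most the energy norm of `e` times `‖z‖ /
√β`. With `z` fixed and `β → ∞`, coercivity forces the energy norm of the error to zero
(`penalization_estimate`, `tendsto_penalization`). No compact embedding is involved.

`tendsto_resolventInv` is stated along an arbitrary filter with moving data `W i`. The filter
`atTop` with constant data gives the first claim. The filter `atTop ×ˢ 𝓝[K] W₀` gives locally
uniform convergence on `K`, hence uniform convergence when `K` is compact. -/

namespace SteepWell

open scoped InnerProduct

/-! ### Resolvents and penalization in abstract Hilbert spaces -/

section Abstract

variable {𝕜 : Type*} [RCLike 𝕜] {G L M : Type*}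
  [NormedAddCommGroup G] [InnerProductSpace 𝕜 G] [CompleteSpace G]
  [NormedAddCommGroup L] [InnerProductSpace 𝕜 L] [CompleteSpace L]
  [NormedAddCommGroup M] [InnerProductSpace 𝕜 M] [CompleteSpace M]

/-- The bounded operator `1 + β m†m + κ j†j` on `G`. -/
noncomputable def coerciveOp (j : G →L[𝕜] L) (m : G →L[𝕜] M) (β κ : ℝ) : G →L[𝕜] G :=
  ContinuousLinearMap.id 𝕜 G + (β : 𝕜) • (m† ∘L m) + (κ : 𝕜) • (j† ∘L j)

lemma inner_coerciveOp (j : G →L[𝕜] L) (m : G →L[𝕜] M) (β κ : ℝ) (u v : G) :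
    inner 𝕜 v (coerciveOp j m β κ u)
      = inner 𝕜 v u + β * inner 𝕜 (m v) (m u) + κ * inner 𝕜 (j v) (j u) := by
  simp [coerciveOp, inner_add_right, inner_smul_right, ContinuousLinearMap.adjoint_inner_right]

lemma re_inner_coerciveOp_self (j : G →L[𝕜] L) (m : G →L[𝕜] M) (β κ : ℝ) (u : G) :
    RCLike.re (inner 𝕜 u (coerciveOp j m β κ u))
      = ‖u‖ ^ 2 + β * ‖m u‖ ^ 2 + κ * ‖j u‖ ^ 2 := by
  simp only [inner_coerciveOp, inner_self_eq_norm_sq_to_K]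
  norm_cast

/-- The constant does not depend on `β`. A negative `κ ‖j u‖²` is absorbed by `‖u‖²`, since `‖j u‖ ≤
‖u‖`. -/
lemma coerciveOp_lower_bound {j : G →L[𝕜] L} (hj : ∀ u, ‖j u‖ ≤ ‖u‖) (m : G →L[𝕜] M)
    {β κ : ℝ} (hβ : 0 ≤ β) (u : G) :
    min 1 (1 + κ) * (‖u‖ ^ 2 + β * ‖m u‖ ^ 2)
      ≤ RCLike.re (inner 𝕜 u (coerciveOp j m β κ u)) := by
  rw [re_inner_coerciveOp_self]
  have h1 : ‖j u‖ ^ 2 ≤ ‖u‖ ^ 2 := by gcongr; exact hj u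
  have h2 : 0 ≤ β * ‖m u‖ ^ 2 := by positivity
  rcases le_total 0 κ with h | h
  · rw [min_eq_left (by linarith)]
    nlinarith [mul_nonneg h (sq_nonneg ‖j u‖)]
  · rw [min_eq_right (by linarith)]
    nlinarith

/-- Lax–Milgram: the lower bound is strictly positive once `κ > -1`. -/
lemma isUnit_coerciveOp {j : G →L[𝕜] L} (hj : ∀ u, ‖j u‖ ≤ ‖u‖) (m : G →L[𝕜] M)
    {β κ : ℝ} (hβ : 0 ≤ β) (hκ : -1 < κ) : IsUnit (coerciveOp j m β κ) := by
  have hc : 0 < min 1 (1 + κ) := lt_min one_pos (by linarith)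
  refine ContinuousLinearMap.isUnit_of_forall_le_norm_inner_map _
    (c := ⟨min 1 (1 + κ), hc.le⟩) hc fun u => ?_
  have h := coerciveOp_lower_bound (κ := κ) hj m hβ u
  have h2 : 0 ≤ min 1 (1 + κ) * (β * ‖m u‖ ^ 2) := by positivity
  calc ‖u‖ ^ 2 * min 1 (1 + κ)
      ≤ RCLike.re (inner 𝕜 u (coerciveOp j m β κ u)) := by nlinarith
    _ ≤ ‖inner 𝕜 u (coerciveOp j m β κ u)‖ := RCLike.re_le_norm _
    _ = _ := norm_inner_symm _ _

/-- Existence of the resolvent of the first-order system, together with the variational equation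
that determines it. -/
lemma exists_isInverseShift_waveOp {j : G →L[𝕜] L} (hinj : Function.Injective j)
    (hj : ∀ u, ‖j u‖ ≤ ‖u‖) (m : G →L[𝕜] M) {β γ μ : ℝ} (hβ : 0 ≤ β)
    (hκ : -1 < μ * (γ + μ)) {A : L →ₗ.[𝕜] L} {a : G →ₗ[𝕜] G →ₗ⋆[𝕜] 𝕜}
    (hA : A.graph = formGraph j a)
    (ha : ∀ u v, a u v = inner 𝕜 v u + β * inner 𝕜 (m v) (m u)) :
    ∃ R : WithLp 2 (G × L) →L[𝕜] WithLp 2 (G × L),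
      IsInverseShift (waveOp j hinj A γ) (μ : 𝕜) R ∧
      ∀ H, (R H).snd = j H.fst + (μ : 𝕜) • j (R H).fst ∧
        coerciveOp j m β (μ * (γ + μ)) (R H).fst = (j†) (-H.snd - ((γ + μ : ℝ) : 𝕜) • j H.fst) := by
  set κ := μ * (γ + μ) with hκdef
  obtain ⟨S, hS1, hS2⟩ := isUnit_iff_exists.1 (isUnit_coerciveOp hj m hβ hκ)
  have hTS : ∀ x, coerciveOp j m β κ (S x) = x := DFunLike.congr_fun hS1
  have hST : ∀ x, S (coerciveOp j m β κ x) = x := DFunLike.congr_fun hS2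
  let P1 : WithLp 2 (G × L) →L[𝕜] G := WithLp.fstL 2 𝕜 G L
  let P2 : WithLp 2 (G × L) →L[𝕜] L := WithLp.sndL 2 𝕜 G L
  -- First component of the resolvent: the solution of the elliptic equation left after eliminating
  -- the second component.
  let u : WithLp 2 (G × L) →L[𝕜] G :=
    S ∘L (j†) ∘L (-P2 - ((γ + μ : ℝ) : 𝕜) • (j ∘L P1))
  let R : WithLp 2 (G × L) →L[𝕜] WithLp 2 (G × L) :=
    (WithLp.prodContinuousLinearEquiv 2 𝕜 G L).symm.toContinuousLinearMap ∘L
      (u.prod (j ∘L P1 + (μ : 𝕜) • (j ∘L u)))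
  have hRu : ∀ H, (R H).fst = u H := fun H => rfl
  have hR2 : ∀ H, (R H).snd = j H.fst + (μ : 𝕜) • j (u H) := fun H => rfl
  have hu : ∀ H, coerciveOp j m β κ (u H) = (j†) (-H.snd - ((γ + μ : ℝ) : 𝕜) • j H.fst) :=
    fun H => hTS _
  have hu' : ∀ H, u H = S ((j†) (-H.snd - ((γ + μ : ℝ) : 𝕜) • j H.fst)) := fun H => rfl
  refine ⟨R, ⟨fun H => ?_, fun U => ?_⟩, fun H => ⟨hR2 H, hu H⟩⟩
  -- `w` is what `A u` has to be according to the elliptic equation `A u + κ u = -g - (γ + μ) f`.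
  · set w : L := -H.snd - ((γ + μ : ℝ) : 𝕜) • j H.fst - (κ : 𝕜) • j (u H) with hw
    have hg : (j (u H), w) ∈ A.graph := by
      rw [hA]
      refine ⟨u H, rfl, fun v => ?_⟩
      have h1 : inner 𝕜 v (coerciveOp j m β κ (u H))
          = inner 𝕜 (j v) (-H.snd - ((γ + μ : ℝ) : 𝕜) • j H.fst) := by
        rw [hu, ContinuousLinearMap.adjoint_inner_right]
      rw [inner_coerciveOp] at h1
      rw [ha, hw, inner_sub_right, ← h1, inner_smul_right]
      ring
    obtain ⟨y, hy1, hy2⟩ := (LinearPMap.mem_graph_iff A).1 hg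
    have hd1 : j (R H).fst ∈ A.domain := by
      have : (y : L) = j (R H).fst := hy1
      rw [← this]; exact y.2
    have hd2 : (R H).snd ∈ (j : G →ₗ[𝕜] L).range :=
      ⟨H.fst + (μ : 𝕜) • u H, by rw [hR2]; simp⟩
    have hAy : A ⟨j (R H).fst, hd1⟩ = w := by
      have : (⟨j (R H).fst, hd1⟩ : A.domain) = y := Subtype.ext hy1.symm
      rw [this]; exact hy2
    refine ⟨⟨R H, hd1, hd2⟩, rfl, ?_⟩
    have e1 : (LinearEquiv.ofInjective (j : G →ₗ[𝕜] L) hinj).symm ⟨(R H).snd, hd2⟩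
        = H.fst + (μ : 𝕜) • u H := by
      rw [LinearEquiv.symm_apply_eq]
      exact Subtype.ext ((hR2 H).trans (by simp))
    apply WithLp.ofLp_injective
    refine Prod.ext ?_ ?_
    · change (LinearEquiv.ofInjective (j : G →ₗ[𝕜] L) hinj).symm ⟨(R H).snd, hd2⟩
        - (μ : 𝕜) • (R H).fst = H.fst
      rw [e1, hRu, add_sub_cancel_right]
    · change -A ⟨j (R H).fst, hd1⟩ - (γ : 𝕜) • (R H).snd - (μ : 𝕜) • (R H).snd = H.snd
      rw [hAy, hR2, hw, hκdef]
      push_cast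
      module
  · obtain ⟨U, hd1, hd2⟩ := U
    obtain ⟨v', hv'⟩ := id hd2
    have hv' : j v' = U.snd := hv'
    have e1 : (LinearEquiv.ofInjective (j : G →ₗ[𝕜] L) hinj).symm ⟨U.snd, hd2⟩ = v' := by
      rw [LinearEquiv.symm_apply_eq]
      exact Subtype.ext hv'.symm
    set w := A ⟨j U.fst, hd1⟩ with hw
    have hg : (j U.fst, w) ∈ formGraph j a := by
      rw [← hA]; exact A.mem_graph ⟨j U.fst, hd1⟩
    obtain ⟨u', hu1, hu2⟩ := hg
    obtain rfl : u' = U.fst := hinj hu1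
    set H : WithLp 2 (G × L) :=
      waveOp j hinj A γ ⟨U, hd1, hd2⟩ - (μ : 𝕜) • U with hH
    have hH1 : H.fst = v' - (μ : 𝕜) • U.fst := by
      change (LinearEquiv.ofInjective (j : G →ₗ[𝕜] L) hinj).symm ⟨U.snd, hd2⟩
        - (μ : 𝕜) • U.fst = _
      rw [e1]
    have hH2 : H.snd = -w - (γ : 𝕜) • U.snd - (μ : 𝕜) • U.snd := rfl
    -- Left inverse: `U.fst` solves the same coercive equation as `u H`, and `S` inverts that
    -- operator.
    have huH : u H = U.fst := by
      rw [hu', ← hST U.fst]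
      congr 1
      refine ext_inner_left 𝕜 fun v => ?_
      rw [ContinuousLinearMap.adjoint_inner_right, inner_coerciveOp, ← ha, ← hu2]
      have : -H.snd - ((γ + μ : ℝ) : 𝕜) • j H.fst = w + (κ : 𝕜) • j U.fst := by
        rw [hH1, hH2, map_sub, map_smul, hv', hκdef]
        push_cast
        module
      rw [this, inner_add_right, inner_smul_right]
    apply WithLp.ofLp_injective
    refine Prod.ext ?_ ?_
    · exact huH
    · change (R H).snd = U.snd
      rw [hR2, huH, hH1, map_sub, map_smul, hv', sub_add_cancel]

/-- A quantitative comparison of the solution `u` of the penalized problem with the solution `u₀`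
of the limit problem. -/
lemma penalization_estimate {j : G →L[𝕜] L} (hj : ∀ u, ‖j u‖ ≤ ‖u‖) (m : G →L[𝕜] M)
    {β κ : ℝ} (hβ : 0 < β) {u u₀ : G} {h h₀ : L} (hu₀ : m u₀ = 0)
    (hu : coerciveOp j m β κ u = (j†) h) (z : M) :
    min 1 (1 + κ) * √(‖u - u₀‖ ^ 2 + β * ‖m (u - u₀)‖ ^ 2)
      ≤ ‖h - h₀‖ + ‖(j†) h₀ - coerciveOp j m 0 κ u₀ - (m†) z‖ + ‖z‖ / √β := by
  set e := u - u₀ with he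
  set n := √(‖e‖ ^ 2 + β * ‖m e‖ ^ 2) with hn
  have hsq : n ^ 2 = ‖e‖ ^ 2 + β * ‖m e‖ ^ 2 := Real.sq_sqrt (by positivity)
  set r := (j†) h₀ - coerciveOp j m 0 κ u₀ - (m†) z with hr
  have h1 : ‖e‖ ≤ n := Real.le_sqrt_of_sq_le (by have : 0 ≤ β * ‖m e‖ ^ 2 := by positivity
                                                 linarith)
  -- Only the penalty term gains the factor `1 / √β`; this is what makes the contribution of `z`
  -- vanish in the limit.
  have h2 : ‖m e‖ ≤ n / √β := by
    rw [le_div_iff₀ (Real.sqrt_pos.2 hβ)]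
    refine Real.le_sqrt_of_sq_le ?_
    rw [mul_pow, Real.sq_sqrt hβ.le]
    nlinarith [sq_nonneg ‖e‖]
  have key : (inner 𝕜 e (coerciveOp j m β κ e) : 𝕜)
      = inner 𝕜 (j e) (h - h₀) + inner 𝕜 e r + inner 𝕜 (m e) z := by
    -- The penalty does not see `u₀`, so its residual is independent of `β`.
    have t : coerciveOp j m β κ u₀ = coerciveOp j m 0 κ u₀ := by simp [coerciveOp, hu₀]
    have : coerciveOp j m β κ e = (j†) (h - h₀) + r + (m†) z := by
      rw [he, map_sub, hu, t, hr, map_sub]; abel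
    rw [this, inner_add_right, inner_add_right, ContinuousLinearMap.adjoint_inner_right,
      ContinuousLinearMap.adjoint_inner_right]
  have hlow := coerciveOp_lower_bound (κ := κ) hj m hβ.le e
  have hup : RCLike.re (inner 𝕜 e (coerciveOp j m β κ e))
      ≤ n * (‖h - h₀‖ + ‖r‖ + ‖z‖ / √β) := by
    have i1 : RCLike.re (inner 𝕜 (j e) (h - h₀)) ≤ n * ‖h - h₀‖ :=
      (re_inner_le_norm _ _).trans (by gcongr; exact (hj e).trans h1)
    have i2 : RCLike.re (inner 𝕜 e r) ≤ n * ‖r‖ :=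
      (re_inner_le_norm _ _).trans (by gcongr)
    have i3 : RCLike.re (inner 𝕜 (m e) z) ≤ n / √β * ‖z‖ :=
      (re_inner_le_norm _ _).trans (by gcongr)
    rw [key, map_add, map_add]
    calc _ ≤ n * ‖h - h₀‖ + n * ‖r‖ + n / √β * ‖z‖ := by gcongr
      _ = _ := by ring
  rw [← hsq] at hlow
  rcases (Real.sqrt_nonneg _ : 0 ≤ n).eq_or_lt with hz | hp
  · replace hz : n = 0 := hz.symm
    rw [hz, mul_zero]; positivity
  · refine le_of_mul_le_mul_left ?_ hp
    calc n * (min 1 (1 + κ) * n) = min 1 (1 + κ) * n ^ 2 := by ring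
      _ ≤ _ := hlow.trans hup

/-- Convergence of the solutions of the penalized problems to those of the limit problem on
`ker m`. -/
lemma tendsto_penalization {j : G →L[𝕜] L} (hj : ∀ u, ‖j u‖ ≤ ‖u‖) (m : G →L[𝕜] M)
    {κ : ℝ} (hκ : -1 < κ) {ι : Type*} {l : Filter ι} {β : ι → ℝ} (hβ : ∀ i, 0 < β i)
    (hβlim : Tendsto β l atTop) {u u₀ : ι → G} {h h₀ : ι → L} {uinf : G} {hinf : L}
    (hu : ∀ i, coerciveOp j m (β i) κ (u i) = (j†) (h i)) (hu₀ : ∀ i, m (u₀ i) = 0)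
    (huinf : ∀ v, m v = 0 →
      inner 𝕜 v uinf + κ * inner 𝕜 (j v) (j uinf) = inner 𝕜 (j v) hinf)
    (hh : Tendsto (fun i => h i - h₀ i) l (𝓝 0)) (hh₀ : Tendsto h₀ l (𝓝 hinf))
    (hu₀lim : Tendsto u₀ l (𝓝 uinf)) :
    Tendsto (fun i => √(‖u i - u₀ i‖ ^ 2 + β i * ‖m (u i - u₀ i)‖ ^ 2)) l (𝓝 0) := by
  have hc : 0 < min 1 (1 + κ) := lt_min one_pos (by linarith)
  set r : G := (j†) hinf - coerciveOp j m 0 κ uinf with hr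
  -- The limit equation is tested only on `ker m`, so `r` need not vanish; it is merely orthogonal
  -- to `ker m`.
  have hcl : r ∈ closure (Set.range (m†)) := by
    have h1 : r ∈ m.kerᗮ := by
      rw [Submodule.mem_orthogonal]
      intro v hv
      have := huinf v hv
      rw [hr, inner_sub_right, inner_coerciveOp, ContinuousLinearMap.adjoint_inner_right, ← this]
      simp
    rw [ContinuousLinearMap.orthogonal_ker] at h1
    exact h1
  have key : Tendsto
      (fun i => min 1 (1 + κ) * √(‖u i - u₀ i‖ ^ 2 + β i * ‖m (u i - u₀ i)‖ ^ 2)) l (𝓝 0) := by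
    rw [Metric.tendsto_nhds]
    intro ε hε
    -- `z` is fixed before passing to the limit. It may blow up as `ε → 0`, but for each `ε` the
    -- term `‖z‖ / √β` still tends to zero.
    obtain ⟨_, ⟨z, rfl⟩, hz⟩ := Metric.mem_closure_iff.1 hcl ε hε
    have hlim : Tendsto (fun i => ‖h i - h₀ i‖
        + ‖(j†) (h₀ i) - coerciveOp j m 0 κ (u₀ i) - (m†) z‖ + ‖z‖ / √(β i)) l
        (𝓝 (‖(0 : L)‖ + ‖r - (m†) z‖ + 0)) := by
      refine (hh.norm.add ?_).add ?_
      · exact (((((j†).continuous.tendsto _).comp hh₀).sub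
          (((coerciveOp j m 0 κ).continuous.tendsto _).comp hu₀lim)).sub_const _).norm
      · exact (Real.tendsto_sqrt_atTop.comp hβlim).const_div_atTop _
    rw [norm_zero, zero_add, add_zero] at hlim
    rw [dist_eq_norm] at hz
    filter_upwards [hlim.eventually (gt_mem_nhds hz)] with i hi
    rw [Real.dist_0_eq_abs, abs_of_nonneg (by positivity)]
    exact (penalization_estimate hj m (hβ i) (hu₀ i) (hu i) z).trans_lt hi
  have := key.const_mul (min 1 (1 + κ))⁻¹
  simpa [← mul_assoc, inv_mul_cancel₀ hc.ne'] using this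

end Abstract

/-! ### The zero set of the potential -/

section Measure

variable {N : ℕ}

/-- The boundary of an open set with `C²` boundary is a null set. -/
lemma volume_frontier_eq_zero {Ω : Set (E N)} (hΩ : IsOpen Ω) (h : HasC2Boundary Ω) :
    volume (frontier Ω) = 0 := by
  refine measure_null_of_locally_null _ fun x₀ hx₀ => ?_
  obtain ⟨U, ρ, hU, hxU, hρ, hd, hiff⟩ := h x₀ hx₀
  have hzero : ∀ x ∈ frontier Ω ∩ U, ρ x = 0 := by
    rintro x ⟨hx, hxU⟩
    have hxΩ : x ∉ Ω := by
      rw [hΩ.frontier_eq] at hx; exact hx.2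
    by_contra hne
    have hpos : 0 < ρ x := lt_of_le_of_ne (not_lt.1 fun hlt => hxΩ ((hiff x hxU).2 hlt)) (Ne.symm hne)
    have hcont : ContinuousAt ρ x := hρ.continuousOn.continuousAt (hU.mem_nhds hxU)
    have hev := (hcont.eventually (lt_mem_nhds hpos)).and (hU.mem_nhds hxU)
    obtain ⟨y, hyΩ, hy⟩ :=
      ((mem_closure_iff_frequently.1 hx.1).and_eventually hev).exists
    exact absurd ((hiff y hy.2).1 hyΩ) (not_lt.2 hy.1.le)
  have hdc : ContinuousAt (fderiv ℝ ρ) x₀ :=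
    (hρ.continuousOn_fderiv_of_isOpen hU (by norm_num)).continuousAt (hU.mem_nhds hxU)
  have hev : ∀ᶠ x in 𝓝 x₀, fderiv ℝ ρ x ≠ 0 := hdc.eventually_ne hd
  obtain ⟨W, hWsub, hW, hxW⟩ := mem_nhds_iff.1 (hev.and (hU.mem_nhds hxU))
  set s := frontier Ω ∩ W with hs
  have hsm : MeasurableSet s := isClosed_frontier.measurableSet.inter hW.measurableSet
  refine ⟨s, inter_mem_nhdsWithin _ (hW.mem_nhds hxW), ?_⟩
  -- Multiplying `ρ` by a fixed nonzero vector `a` makes it a self-map of `E N`, as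
  -- `ApproximatesLinearOn.norm_fderiv_sub_le` requires.
  obtain ⟨a, ha⟩ : ∃ a : E N, a ≠ 0 := by
    by_contra! hall
    exact hd (ContinuousLinearMap.ext fun x => by rw [hall x]; simp)
  -- The map is zero on `s`, hence approximated there by the zero map with constant `0`. Its
  -- derivative then vanishes at a.e. point of `s`, whereas `fderiv ℝ ρ` has no zero on `W`; so `s`
  -- is null.
  have happ : ApproximatesLinearOn (fun x => ρ x • a) (0 : E N →L[ℝ] E N) s 0 := by
    intro x hx y hy
    simp [hzero x ⟨hx.1, (hWsub hx.2).2⟩, hzero y ⟨hy.1, (hWsub hy.2).2⟩]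
  have hae := happ.norm_fderiv_sub_le volume hsm (fun x => (fderiv ℝ ρ x).smulRight a)
    (fun x hx => by
      have : DifferentiableAt ℝ ρ x :=
        (hρ.differentiableOn (by norm_num)).differentiableAt (hU.mem_nhds (hWsub hx.2).2)
      exact (this.hasFDerivAt.smul_const a).hasFDerivWithinAt)
  rw [ae_restrict_iff' hsm] at hae
  rw [measure_eq_zero_iff_ae_notMem]
  filter_upwards [hae] with x hx hxs
  have h0 := hx hxs
  simp only [sub_zero, nonpos_iff_eq_zero, nnnorm_eq_zero] at h0
  refine (hWsub hxs.2).1 (ContinuousLinearMap.ext fun y => ?_)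
  have := DFunLike.congr_fun h0 y
  simpa [ha] using this

/-- A well potential is positive a.e. outside the closure of its bottom. -/
lemma IsWellPotential.ae_pos {Ω : Set (E N)} {V : E N → ℝ} (hV : IsWellPotential Ω V) :
    ∀ᵐ x : E N, x ∉ closure Ω → 0 < V x := by
  rw [ae_iff]
  -- Each point off `closure Ω` has a closed ball off `closure Ω`, on which `V` has a positive
  -- essential lower bound.
  refine measure_null_of_locally_null _ fun x₀ hx₀ => ?_
  have hx₀ : x₀ ∉ closure Ω := by
    intro hx; exact hx₀ fun h => absurd hx h
  obtain ⟨r, hr, hsub⟩ := Metric.nhds_basis_closedBall.mem_iff.1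
    (isClosed_closure.isOpen_compl.mem_nhds hx₀)
  obtain ⟨c, hc, hae⟩ := hV.essInf_pos x₀ r hr hsub
  refine ⟨_, inter_mem_nhdsWithin _ (Metric.closedBall_mem_nhds x₀ hr), ?_⟩
  rw [measure_eq_zero_iff_ae_notMem]
  filter_upwards [hae] with x hx hxs
  exact hxs.1 fun _ => hc.trans_le (hx hxs.2)

/-- A well potential vanishes exactly on its bottom, up to a null set. -/
lemma IsWellPotential.ae_eq_zero_iff {Ω : Set (E N)} {V : E N → ℝ} (hΩ : IsOpen Ω)
    (hΩ2 : HasC2Boundary Ω) (hV : IsWellPotential Ω V) :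
    ∀ᵐ x : E N, V x = 0 ↔ x ∈ Ω := by
  filter_upwards [hV.ae_pos, hV.eq_zero,
    measure_eq_zero_iff_ae_notMem.1 (volume_frontier_eq_zero hΩ hΩ2)] with x h1 h2 h3
  refine ⟨fun h => ?_, fun h => h2 (subset_closure h)⟩
  by_contra hx
  rw [hΩ.frontier_eq] at h3
  exact (h1 fun hc => h3 ⟨hc, hx⟩).ne' h

end Measure

/-! ### Multiplication by `√V`, the energy form and completeness of `H¹` -/

section Functions

variable {𝕜 : Type*} [RCLike 𝕜] {N : ℕ} {Ω : Set (E N)} {V : E N → ℝ}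

lemma IsWellPotential.memLp_sqrt_smul (hV : IsWellPotential Ω V) (u : L2 𝕜 N) :
    MemLp (fun x => √(V x) • u x) 2 (volume : Measure (E N)) := by
  refine (Lp.memLp u).of_le ?_ ?_
  · exact hV.aemeasurable.sqrt.aestronglyMeasurable.smul (Lp.aestronglyMeasurable u)
  · filter_upwards [hV.mem_Icc] with x hx
    rw [norm_smul, Real.norm_of_nonneg (Real.sqrt_nonneg _)]
    exact mul_le_of_le_one_left (norm_nonneg _) (Real.sqrt_le_one.2 hx.2)

/-- Multiplication by `√V` on `L²`. -/
noncomputable def mulSqrt (𝕜 : Type*) [RCLike 𝕜] (hV : IsWellPotential Ω V) :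
    L2 𝕜 N →L[𝕜] L2 𝕜 N :=
  LinearMap.mkContinuous
    { toFun := fun u => (hV.memLp_sqrt_smul u).toLp _
      map_add' := fun u v => by
        rw [← MemLp.toLp_add]
        refine MemLp.toLp_congr _ _ ?_
        filter_upwards [Lp.coeFn_add u v] with x hx
        simp only [hx, Pi.add_apply, smul_add]
      map_smul' := fun c u => by
        rw [RingHom.id_apply, ← MemLp.toLp_const_smul]
        refine MemLp.toLp_congr _ _ ?_
        filter_upwards [Lp.coeFn_smul c u] with x hx
        simp only [hx, Pi.smul_apply, smul_comm c] }
    1 (fun u => by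
      rw [one_mul]
      refine Lp.norm_le_norm_of_ae_le ?_
      filter_upwards [hV.mem_Icc, (hV.memLp_sqrt_smul u).coeFn_toLp] with x hx hx'
      change ‖(hV.memLp_sqrt_smul u).toLp _ x‖ ≤ _
      rw [hx', norm_smul, Real.norm_of_nonneg (Real.sqrt_nonneg _)]
      exact mul_le_of_le_one_left (norm_nonneg _) (Real.sqrt_le_one.2 hx.2))

lemma coeFn_mulSqrt (hV : IsWellPotential Ω V) (u : L2 𝕜 N) :
    ∀ᵐ x : E N, mulSqrt 𝕜 hV u x = √(V x) • u x :=
  (hV.memLp_sqrt_smul u).coeFn_toLp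

lemma mulSqrt_eq_zero_iff (hΩ : IsOpen Ω) (hΩ2 : HasC2Boundary Ω) (hV : IsWellPotential Ω V)
    (u : L2 𝕜 N) : mulSqrt 𝕜 hV u = 0 ↔ u ∈ L2Ω 𝕜 Ω := by
  rw [Lp.eq_zero_iff_ae_eq_zero]
  change _ ↔ ∀ᵐ x : E N, x ∉ Ω → u x = 0
  refine eventually_congr ?_ |>.trans Iff.rfl
  filter_upwards [coeFn_mulSqrt hV u, hV.ae_eq_zero_iff hΩ hΩ2, hV.mem_Icc] with x h1 h2 h3
  rw [h1, Pi.zero_apply, smul_eq_zero, Real.sqrt_eq_zero h3.1, h2]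
  tauto

lemma inner_mulSqrt (hV : IsWellPotential Ω V) (u v : L2 𝕜 N) :
    inner 𝕜 (mulSqrt 𝕜 hV v) (mulSqrt 𝕜 hV u)
      = ∫ x : E N, V x • (inner 𝕜 (v x) (u x) : 𝕜) := by
  rw [L2.inner_def]
  refine integral_congr_ae ?_
  filter_upwards [coeFn_mulSqrt hV u, coeFn_mulSqrt hV v, hV.mem_Icc] with x h1 h2 h3
  rw [h1, h2, RCLike.real_smul_eq_coe_smul (K := 𝕜), RCLike.real_smul_eq_coe_smul (K := 𝕜),
    inner_smul_left, inner_smul_right, RCLike.conj_ofReal, ← mul_assoc, ← RCLike.ofReal_mul,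
    Real.mul_self_sqrt h3.1, RCLike.real_smul_eq_coe_mul]

/-- The map `u ↦ √V u` on `H¹`. -/
noncomputable def sqrtH1 (𝕜 : Type*) [RCLike 𝕜] (hV : IsWellPotential Ω V) :
    H1 𝕜 N →L[𝕜] L2 𝕜 N :=
  mulSqrt 𝕜 hV ∘L toL2 𝕜 N

/-- This identifies the abstract limit space `ker m` with `H¹_Ω`. The null frontier is essential:
`V` vanishes on `closure Ω`, while `H¹_Ω` asks for vanishing off `Ω` itself. -/
lemma sqrtH1_eq_zero_iff (hΩ : IsOpen Ω) (hΩ2 : HasC2Boundary Ω) (hV : IsWellPotential Ω V)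
    (u : H1 𝕜 N) : sqrtH1 𝕜 hV u = 0 ↔ u ∈ H1Ω 𝕜 Ω :=
  mulSqrt_eq_zero_iff hΩ hΩ2 hV _

lemma inner_H1 (u v : H1 𝕜 N) : inner 𝕜 v u
    = inner 𝕜 (toL2 𝕜 N v) (toL2 𝕜 N u)
      + ∑ i : Fin N, inner 𝕜 (partialDeriv i v) (partialDeriv i u) := by
  change inner 𝕜 v.1 u.1 = _
  rw [WithLp.prod_inner_apply, PiLp.inner_apply]
  rfl

/-- Puts `a_β` in the form required by the abstract part, with `m = sqrtH1`. -/
lemma energy_eq (hV : IsWellPotential Ω V) (β : ℝ) (u v : H1 𝕜 N) :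
    energy V β u v = inner 𝕜 v u + β * inner 𝕜 (sqrtH1 𝕜 hV v) (sqrtH1 𝕜 hV u) := by
  have h1 := L2.integrable_inner (𝕜 := 𝕜) (toL2 𝕜 N v) (toL2 𝕜 N u)
  have h2 := (integrable_energy hV 1 (toL2 𝕜 N v) (toL2 𝕜 N u)).sub h1
  -- Integrability comes from writing `V = (1 + 1 * V) - 1`.
  have h3 : Integrable fun x : E N =>
      V x • (inner 𝕜 (toL2 𝕜 N v x) (toL2 𝕜 N u x) : 𝕜) := by
    refine h2.congr (Eventually.of_forall fun x => ?_)
    simp only [Pi.sub_apply, one_mul, add_smul, one_smul, add_sub_cancel_left]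
  have h4 : ∫ x : E N, (1 + β * V x) • (inner 𝕜 (toL2 𝕜 N v x) (toL2 𝕜 N u x) : 𝕜)
      = inner 𝕜 (toL2 𝕜 N v) (toL2 𝕜 N u)
        + β * inner 𝕜 (sqrtH1 𝕜 hV v) (sqrtH1 𝕜 hV u) := by
    change _ = _ + β * inner 𝕜 (mulSqrt 𝕜 hV (toL2 𝕜 N v)) (mulSqrt 𝕜 hV (toL2 𝕜 N u))
    rw [inner_mulSqrt, L2.inner_def, ← integral_const_mul,
      ← integral_add h1 (h3.const_mul _)]
    refine integral_congr_ae (Eventually.of_forall fun x => ?_)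
    simp only [add_smul, one_smul, mul_smul, RCLike.real_smul_eq_coe_mul]
  rw [energy, h4, inner_H1]
  ring

lemma norm1_eq (hV : IsWellPotential Ω V) (β : ℝ) (u : H1 𝕜 N) :
    norm1 V β u = √(‖u‖ ^ 2 + β * ‖sqrtH1 𝕜 hV u‖ ^ 2) := by
  rw [norm1, energy_eq hV]
  simp only [inner_self_eq_norm_sq_to_K]
  norm_cast

lemma norm_toL2_le (u : H1 𝕜 N) : ‖toL2 𝕜 N u‖ ≤ ‖u‖ :=
  WithLp.norm_fst_le _ u.1

/-- `H1Submodule` is closed: each test integral is an inner product with a fixed `L²` function, so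
the weak-derivative identities pass to limits. -/
instance : CompleteSpace (H1 𝕜 N) := by
  have hcont : ∀ ψ : E N → ℝ, Continuous ψ → HasCompactSupport ψ →
      Continuous fun u : L2 𝕜 N => ∫ x, ψ x • u x := by
    intro ψ hc hs
    have hmem : MemLp (fun x => (ψ x : 𝕜)) 2 (volume : Measure (E N)) :=
      (RCLike.continuous_ofReal.comp hc).memLp_of_hasCompactSupport
        (hs.comp_left (g := ((↑) : ℝ → 𝕜)) (by simp))
    have : (fun u : L2 𝕜 N => ∫ x, ψ x • u x) = fun u => inner 𝕜 (hmem.toLp _) u := by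
      ext u
      rw [L2.inner_def]
      refine integral_congr_ae ?_
      filter_upwards [hmem.coeFn_toLp] with x hx
      rw [hx, RCLike.inner_apply, RCLike.conj_ofReal, RCLike.real_smul_eq_coe_mul, mul_comm]
    rw [this]
    fun_prop
  have hcl : IsClosed (H1Submodule 𝕜 N :
      Set (WithLp 2 (L2 𝕜 N × PiLp 2 (fun _ : Fin N => L2 𝕜 N)))) := by
    change IsClosed {p : WithLp 2 (L2 𝕜 N × PiLp 2 (fun _ : Fin N => L2 𝕜 N)) | ∀ i, IsWeakPartial i p.fst (p.snd i)}
    simp only [IsWeakPartial, Set.ofPred_forall]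
    refine isClosed_iInter fun i => isClosed_iInter fun φ => isClosed_iInter fun hφ =>
      isClosed_iInter fun hs => isClosed_eq ?_ ?_
    · exact (hcont _ (continuous_partial hφ _) (hs.fderiv_apply ℝ _)).comp
        (WithLp.fstL 2 𝕜 (L2 𝕜 N) (PiLp 2 (fun _ : Fin N => L2 𝕜 N))).continuous
    · exact ((hcont _ hφ.continuous hs).comp ((PiLp.proj 2 (fun _ : Fin N => L2 𝕜 N) i
        (𝕜 := 𝕜)).continuous.comp
        (WithLp.sndL 2 𝕜 (L2 𝕜 N) (PiLp 2 (fun _ : Fin N => L2 𝕜 N))).continuous)).neg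
  exact hcl.completeSpace_coe

end Functions

/-! ### Resolvents of `B_β` and `B_Ω`, and their convergence -/

section Convergence

variable {𝕜 : Type*} [RCLike 𝕜] {N : ℕ} {Ω : Set (E N)} {V : E N → ℝ}

/-- Closedness is immediate because the subspace is the kernel of a bounded operator. Completeness
is what provides the adjoint of `toL2Ω`. -/
lemma completeSpace_L2Ω (hΩ : IsOpen Ω) (hΩ2 : HasC2Boundary Ω) (hV : IsWellPotential Ω V) :
    CompleteSpace (L2Ω 𝕜 Ω) := by
  have h : L2Ω 𝕜 Ω = (mulSqrt 𝕜 hV).ker := by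
    ext u; exact (mulSqrt_eq_zero_iff hΩ hΩ2 hV u).symm
  have hcl : IsClosed (L2Ω 𝕜 Ω : Set (L2 𝕜 N)) := by
    rw [h]; exact (mulSqrt 𝕜 hV).isClosed_ker
  exact hcl.completeSpace_coe

lemma completeSpace_H1Ω (hΩ : IsOpen Ω) (hΩ2 : HasC2Boundary Ω) (hV : IsWellPotential Ω V) :
    CompleteSpace (H1Ω 𝕜 Ω) := by
  have h : H1Ω 𝕜 Ω = (sqrtH1 𝕜 hV).ker := by
    ext u; exact (sqrtH1_eq_zero_iff hΩ hΩ2 hV u).symm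
  have hcl : IsClosed (H1Ω 𝕜 Ω : Set (H1 𝕜 N)) := by
    rw [h]; exact (sqrtH1 𝕜 hV).isClosed_ker
  exact hcl.completeSpace_coe

lemma norm_toL2Ω_le (u : H1Ω 𝕜 Ω) : ‖toL2Ω 𝕜 Ω u‖ ≤ ‖u‖ :=
  norm_toL2_le (u : H1 𝕜 N)

lemma norm_le_norm1 (hV : IsWellPotential Ω V) {β : ℝ} (hβ : 0 ≤ β) (u : H1 𝕜 N) :
    ‖u‖ ≤ norm1 V β u := by
  rw [norm1_eq hV]
  exact Real.le_sqrt_of_sq_le (le_add_of_nonneg_right (by positivity))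

lemma norm1_le_normX (V : E N → ℝ) (β : ℝ) (U : X 𝕜 N) : norm1 V β U.fst ≤ normX V β U :=
  Real.le_sqrt_of_sq_le (le_add_of_nonneg_right (by positivity))

lemma norm_snd_le_normX (V : E N → ℝ) (β : ℝ) (U : X 𝕜 N) : ‖U.snd‖ ≤ normX V β U :=
  Real.le_sqrt_of_sq_le (le_add_of_nonneg_left (by positivity))

set_option maxHeartbeats 1600000 in
/-- The resolvent of `B_β` and the equations that determine it. -/
lemma exists_isInverseShift_Bβ (hV : IsWellPotential Ω V) {β γ μ : ℝ} (hβ : 0 ≤ β)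
    (hκ : -1 < μ * (γ + μ)) :
    ∃ R : X 𝕜 N →L[𝕜] X 𝕜 N, IsInverseShift (Bβ 𝕜 hV γ β) (μ : 𝕜) R ∧
      ∀ H, (R H).snd = toL2 𝕜 N H.fst + (μ : 𝕜) • toL2 𝕜 N (R H).fst ∧
        coerciveOp (toL2 𝕜 N) (sqrtH1 𝕜 hV) β (μ * (γ + μ)) (R H).fst
          = (toL2 𝕜 N).adjoint (-H.snd - ((γ + μ : ℝ) : 𝕜) • toL2 𝕜 N H.fst) :=
  exists_isInverseShift_waveOp toL2_injective norm_toL2_le (sqrtH1 𝕜 hV) hβ hκ (Aβ_graph hV β)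
    (energy_eq hV β)

set_option maxHeartbeats 1600000 in
/-- The resolvent of `B_Ω` and the equations that determine it. -/
lemma exists_isInverseShift_BΩ (hΩ : IsOpen Ω) (hΩ2 : HasC2Boundary Ω)
    (hV : IsWellPotential Ω V) {γ μ : ℝ} (hκ : -1 < μ * (γ + μ)) :
    ∃ R : XΩ 𝕜 Ω →L[𝕜] XΩ 𝕜 Ω, IsInverseShift (BΩ 𝕜 Ω γ) (μ : 𝕜) R ∧
      ∀ W, (R W).snd = toL2Ω 𝕜 Ω W.fst + (μ : 𝕜) • toL2Ω 𝕜 Ω (R W).fst ∧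
        ∀ v : H1 𝕜 N, v ∈ H1Ω 𝕜 Ω →
          inner 𝕜 v ((R W).fst : H1 𝕜 N)
              + ((μ * (γ + μ) : ℝ) : 𝕜) * inner 𝕜 (toL2 𝕜 N v) (toL2 𝕜 N (R W).fst)
            = inner 𝕜 (toL2 𝕜 N v)
                (-(W.snd : L2 𝕜 N) - ((γ + μ : ℝ) : 𝕜) • toL2 𝕜 N W.fst) := by
  have := completeSpace_L2Ω (𝕜 := 𝕜) hΩ hΩ2 hV
  have := completeSpace_H1Ω (𝕜 := 𝕜) hΩ hΩ2 hV
  -- The limit problem carries no penalty, so the abstract lemma applies with `m = 0` and `β = 0`.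
  obtain ⟨R, hR, h⟩ := exists_isInverseShift_waveOp (j := toL2Ω 𝕜 Ω) (γ := γ)
    (toL2Ω_injective Ω) norm_toL2Ω_le (0 : H1Ω 𝕜 Ω →L[𝕜] L2Ω 𝕜 Ω) le_rfl hκ (AΩ_graph hΩ)
    (fun u v => by simp)
  refine ⟨R, hR, fun W => ⟨(h W).1, fun v hv => ?_⟩⟩
  -- Testing against `v` removes the adjoint of `toL2Ω`, which differs from that of `toL2`, and
  -- leaves only inner products of the ambient spaces.
  have h2 := congrArg (inner 𝕜 (⟨v, hv⟩ : H1Ω 𝕜 Ω)) (h W).2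
  rw [inner_coerciveOp, ContinuousLinearMap.adjoint_inner_right, RCLike.ofReal_zero, zero_mul,
    add_zero] at h2
  exact h2

set_option maxHeartbeats 1600000 in
/-- Convergence of the resolvents along an arbitrary filter, with converging right-hand sides. -/
lemma tendsto_resolventInv (hΩ : IsOpen Ω) (hΩ2 : HasC2Boundary Ω) (hV : IsWellPotential Ω V)
    {γ μ : ℝ} (hκ : -1 < μ * (γ + μ)) {ι : Type*} {l : Filter ι} {β : ι → ℝ}
    (hβ : ∀ i, 0 < β i) (hβlim : Tendsto β l atTop) {W : ι → XΩ 𝕜 Ω} {W₀ : XΩ 𝕜 Ω}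
    {H : ι → X 𝕜 N} (hW : Tendsto W l (𝓝 W₀))
    (hH : Tendsto (fun i => normX V (β i) (H i - incl (W i))) l (𝓝 0)) :
    Tendsto (fun i => normX V (β i) (resolventInv (Bβ 𝕜 hV γ (β i)) (μ : 𝕜) (H i)
      - incl (resolventInv (BΩ 𝕜 Ω γ) (μ : 𝕜) (W i)))) l (𝓝 0) := by
  obtain ⟨S, hS, hSeq⟩ := exists_isInverseShift_BΩ (𝕜 := 𝕜) hΩ hΩ2 hV hκ
  choose R hR hReq using fun i => exists_isInverseShift_Bβ (𝕜 := 𝕜) hV (hβ i).le hκ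
  simp only [resolventInv_eq hS, fun i => resolventInv_eq (hR i)]
  set κ := μ * (γ + μ)
  set j := toL2 𝕜 N
  let h : ι → L2 𝕜 N := fun i => -(H i).snd - ((γ + μ : ℝ) : 𝕜) • j (H i).fst
  let h₀ : XΩ 𝕜 Ω → L2 𝕜 N := fun W => -(W.snd : L2 𝕜 N) - ((γ + μ : ℝ) : 𝕜) • j W.fst
  let u₀ : XΩ 𝕜 Ω → H1 𝕜 N := fun W => ((S W).fst : H1 𝕜 N)
  have hfst : ∀ i, ‖(H i).fst - ((W i).fst : H1 𝕜 N)‖ ≤ normX V (β i) (H i - incl (W i)) :=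
    fun i => (norm_le_norm1 hV (hβ i).le _).trans (norm1_le_normX V (β i) (H i - incl (W i)))
  have hsnd : ∀ i, ‖(H i).snd - ((W i).snd : L2 𝕜 N)‖ ≤ normX V (β i) (H i - incl (W i)) :=
    fun i => norm_snd_le_normX V (β i) (H i - incl (W i))
  have hfst0 := squeeze_zero (fun i => norm_nonneg _) hfst hH
  have hsnd0 := squeeze_zero (fun i => norm_nonneg _) hsnd hH
  have hfst' := tendsto_zero_iff_norm_tendsto_zero.2 hfst0
  have hsnd' := tendsto_zero_iff_norm_tendsto_zero.2 hsnd0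
  have hjf : Tendsto (fun i => j ((H i).fst - ((W i).fst : H1 𝕜 N))) l (𝓝 0) := by
    have := (j.continuous.tendsto 0).comp hfst'
    rwa [map_zero] at this
  have hh : Tendsto (fun i => h i - h₀ (W i)) l (𝓝 0) := by
    have := hsnd'.neg.sub (hjf.const_smul ((γ + μ : ℝ) : 𝕜))
    rw [smul_zero, neg_zero, sub_zero] at this
    refine this.congr fun i => ?_
    simp only [h, h₀, map_sub]
    module
  have hh₀c : Continuous h₀ := by
    have h1 : Continuous fun W : XΩ 𝕜 Ω => (W.snd : L2 𝕜 N) :=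
      continuous_subtype_val.comp (WithLp.sndL 2 𝕜 (H1Ω 𝕜 Ω) (L2Ω 𝕜 Ω)).continuous
    have h2 : Continuous fun W : XΩ 𝕜 Ω => j W.fst :=
      j.continuous.comp (continuous_subtype_val.comp
        (WithLp.fstL 2 𝕜 (H1Ω 𝕜 Ω) (L2Ω 𝕜 Ω)).continuous)
    exact h1.neg.sub (h2.const_smul ((γ + μ : ℝ) : 𝕜))
  have hu₀c : Continuous u₀ :=
    continuous_subtype_val.comp
      ((WithLp.fstL 2 𝕜 (H1Ω 𝕜 Ω) (L2Ω 𝕜 Ω)).continuous.comp S.continuous)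
  -- The comparison functions are the moving `u₀ (W i)`, but the limit equation is used only at
  -- `W₀`.
  have hlim := tendsto_penalization (norm_toL2_le (𝕜 := 𝕜)) (sqrtH1 𝕜 hV) hκ hβ hβlim
    (fun i => (hReq i (H i)).2)
    (fun i => (sqrtH1_eq_zero_iff hΩ hΩ2 hV (u₀ (W i))).2 (S (W i)).fst.2)
    (fun v hv => (hSeq W₀).2 v ((sqrtH1_eq_zero_iff hΩ hΩ2 hV v).1 hv)) hh
    ((hh₀c.tendsto W₀).comp hW) ((hu₀c.tendsto W₀).comp hW)
  have hlim1 : Tendsto (fun i => norm1 V (β i) ((R i (H i)).fst - u₀ (W i))) l (𝓝 0) := by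
    simpa only [norm1_eq hV] using hlim
  have hju : Tendsto (fun i => j ((R i (H i)).fst - u₀ (W i))) l (𝓝 0) := by
    have h1 := tendsto_zero_iff_norm_tendsto_zero.2
      (squeeze_zero (fun i => norm_nonneg _) (fun i => norm_le_norm1 hV (hβ i).le _) hlim1)
    have := (j.continuous.tendsto 0).comp h1
    rwa [map_zero] at this
  -- Both second components have the form `j f + μ j u`, so their `L²` convergence follows from that
  -- of the first components and of the data.
  have hlim2 : Tendsto (fun i => (R i (H i)).snd - ((S (W i)).snd : L2 𝕜 N)) l (𝓝 0) := by
    have := hjf.add (hju.const_smul (μ : 𝕜))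
    rw [smul_zero, add_zero] at this
    refine this.congr fun i => ?_
    have e : ((S (W i)).snd : L2 𝕜 N) = j (W i).fst + (μ : 𝕜) • j (u₀ (W i)) :=
      congrArg Subtype.val (hSeq (W i)).1
    rw [(hReq i (H i)).1, e, map_sub, map_sub]
    module
  have := ((hlim1.pow 2).add (hlim2.norm.pow 2)).sqrt
  rw [norm_zero, zero_pow two_ne_zero, add_zero, Real.sqrt_zero] at this
  exact this

end Convergence

/-! ### The condition on `μ`, and the theorem -/

lemma neg_one_lt_mul_add {γ δ μ : ℝ} (hδγ : 2 * δ ≤ γ) (hγδ : γ * δ < 1)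
    (hμ : -δ < μ) : -1 < μ * (γ + μ) := by
  -- Both factors are nonnegative because `γ - δ ≥ δ`. Expanding gives `μ (γ + μ) ≥ δ² - γ δ > -1`.
  have h : 0 ≤ (μ + δ) * (γ + μ - δ) := mul_nonneg (by linarith) (by linarith)
  nlinarith [sq_nonneg δ]

lemma normX_zero {𝕜 : Type*} [RCLike 𝕜] {N : ℕ} {Ω : Set (E N)} {V : E N → ℝ}
    (hV : IsWellPotential Ω V) (β : ℝ) : normX V β (0 : X 𝕜 N) = 0 := by
  simp [normX, norm1_eq hV]

end SteepWell

theorem mainTheorem6 {𝕜 : Type*} [RCLike 𝕜] {N : ℕ} (hN : 0 < N)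
    (Ω : Set (E N)) (hΩ : IsOpen Ω) (hΩb : Bornology.IsBounded Ω) (hΩ2 : HasC2Boundary Ω)
    (V : E N → ℝ) (hV : IsWellPotential Ω V)
    (γ δ μ : ℝ) (hγ : 0 ≤ γ) (hδ : 0 ≤ δ) (hδγ : 2 * δ ≤ γ) (hγδ : γ * δ < 1) (hμ : -δ < μ)
    (β : ℕ → ℝ) (hβ : ∀ n, 0 < β n) (hβlim : Tendsto β atTop atTop) :
    ((∀ n, (μ : 𝕜) ∈ resolventSetOf (Bβ 𝕜 hV γ (β n))) ∧ (μ : 𝕜) ∈ resolventSetOf (BΩ 𝕜 Ω γ)) ∧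
    (∀ (H : XΩ 𝕜 Ω) (Hn : ℕ → X 𝕜 N),
      Tendsto (fun n => normX V (β n) (Hn n - incl H)) atTop (𝓝 0) →
      Tendsto (fun n => normX V (β n)
        (resolventInv (Bβ 𝕜 hV γ (β n)) (μ : 𝕜) (Hn n) - incl (resolventInv (BΩ 𝕜 Ω γ) (μ : 𝕜) H)))
        atTop (𝓝 0)) ∧
    (∀ K : Set (XΩ 𝕜 Ω), IsCompact K →
      TendstoUniformlyOn (fun n W => normX V (β n)
        (resolventInv (Bβ 𝕜 hV γ (β n)) (μ : 𝕜) (incl W) - incl (resolventInv (BΩ 𝕜 Ω γ) (μ : 𝕜) W)))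
        (fun _ => 0) atTop K) := by
  have hκ := neg_one_lt_mul_add hδγ hγδ hμ
  refine ⟨⟨fun n => ?_, ?_⟩, fun H Hn h => ?_, fun K hK => ?_⟩
  · obtain ⟨R, hR, -⟩ := exists_isInverseShift_Bβ (𝕜 := 𝕜) hV (hβ n).le hκ
    exact ⟨R, hR⟩
  · obtain ⟨R, hR, -⟩ := exists_isInverseShift_BΩ (𝕜 := 𝕜) hΩ hΩ2 hV hκ
    exact ⟨R, hR⟩
  · exact tendsto_resolventInv hΩ hΩ2 hV hκ hβ hβlim tendsto_const_nhds h
  · rw [← tendstoLocallyUniformlyOn_iff_tendstoUniformlyOn_of_compact hK,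
      tendstoLocallyUniformlyOn_iff_forall_tendsto]
    intro W₀ _
    -- Here the index is a pair `(n, W)`: joint convergence as `n → ∞` and `W → W₀` within `K` is
    -- locally uniform convergence at `W₀`.
    have h := tendsto_resolventInv (𝕜 := 𝕜) (l := (atTop : Filter ℕ) ×ˢ 𝓝[K] W₀)
      (β := fun p => β p.1) (W := fun p => p.2) (H := fun p => incl p.2) hΩ hΩ2 hV hκ
      (fun p => hβ p.1) (hβlim.comp tendsto_fst)
      (tendsto_nhds_of_tendsto_nhdsWithin tendsto_snd)
      (by simpa only [sub_self, normX_zero hV] using tendsto_const_nhds)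
    exact tendsto_left_nhds_uniformity.comp h
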